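/- Let $n\ge 1$. For $h\ge 1$ and $\mu\in\mathbb C$ let $J_h(\mu)$ be the $h\times h$ Jordan block, with $\mu$ on the diagonal, $1$ on the superdiagonal and $0$ elsewhere; a Jordan matrix is a block-diagonal matrix whose diagonal blocks are Jordan blocks. A double partition of $n$ is a finite multiset $\boldsymbol\lambda=\{\!\!\{\lambda_1,\dots,\lambda_k\}\!\!\}$ of nonempty multisets $\lambda_i=\{\!\!\{\lambda_{i1},\dots,\lambda_{il_i}\}\!\!\}$ of positive integers with $\sum_{i,j}\lambda_{ij}=n$. Its bundle of matrices $\mathcal M_{\boldsymbol\lambda}\subseteq M(n,\mathbb C)$ is the set of all matrices similar to $\bigoplus_{i=1}^{k}\bigoplus_{j=1}^{l_i}J_{\lambda_{ij}}(\mu_i)$ for some pairwise distinct $\mu_1,\dots,\mu_k\in\mathbb C$. Theorem. Let $X$ be a (finite-dimensional) complex manifold and let $A\colon X\to M(n,\mathbb C)$ be holomorphic. Assume that $A(X)\subseteq\mathcal M_{\boldsymbol\lambda}$ for some double partition $\boldsymbol\lambda$ of $n$. Then $A$ is locally holomorphically Jordanizable at every point of $X$: for each $x_o\in X$ there exist an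 open neighborhood $U\subseteq X$ of $x_o$ and a holomorphic map $S\colon U\to GL(n,\mathbb C)$ such that $S(x)^{-1}A(x)S(x)$ is a Jordan matrix for every $x\in U$. -/

import Mathlib

open scoped Manifold ContDiff

noncomputable section

/-- A double partition of `n`: a multiset of (nonempty) multisets of positive integers with
total sum `n`. The members of `parts` are the partitions `n_j = b_{j1} + ... + b_{j l_j}` of the
rough parts `n_j`. -/
structure DoublePartition (n : ℕ) where
  parts : Multiset (Multiset ℕ)
  ne_zero : ∀ p ∈ parts, p ≠ 0
  pos : ∀ p ∈ parts, ∀ b ∈ p, 0 < b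
  sum_eq : (parts.map Multiset.sum).sum = n

/-- The Jordan block `J_h(μ)` of size `h`: `μ` on the diagonal, `1` on the superdiagonal. -/
def jordanBlock (h : ℕ) (μ : ℂ) : Matrix (Fin h) (Fin h) ℂ :=
  Matrix.of fun i j => if i = j then μ else if (i : ℕ) + 1 = (j : ℕ) then 1 else 0

/-- `J` is a Jordan matrix: a direct sum `J_{b_0}(μ_0) ⊕ ... ⊕ J_{b_{m-1}}(μ_{m-1})` of Jordan
blocks, placed in this order along the diagonal (`finSigmaFinEquiv` is the lexicographic
enumeration of the pairs (block, position inside the block)). -/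
def IsJordanMatrix {n : ℕ} (J : Matrix (Fin n) (Fin n) ℂ) : Prop :=
  ∃ (m : ℕ) (b : Fin m → ℕ) (μ : Fin m → ℂ) (h : ∑ i, b i = n),
    (∀ i, 0 < b i) ∧
    J = Matrix.reindex (finSigmaFinEquiv.trans (finCongr h))
      (finSigmaFinEquiv.trans (finCongr h))
      (Matrix.blockDiagonal' fun i => jordanBlock (b i) (μ i))

/-- The direct sum `⊕_i ⊕_j J_{b_{ij}}(μ_i)` of Jordan blocks. -/
def jordanForm {k : ℕ} {l : Fin k → ℕ} (b : (i : Fin k) → Fin (l i) → ℕ) (μ : Fin k → ℂ) :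
    Matrix (Σ i, Σ j, Fin (b i j)) (Σ i, Σ j, Fin (b i j)) ℂ :=
  Matrix.blockDiagonal' fun i => Matrix.blockDiagonal' fun j => jordanBlock (b i j) (μ i)

/-- The bundle of matrices attached to the double partition `lam`: all matrices similar to
`⊕_i ⊕_j J_{b_{ij}}(μ_i)`, where `(b_{ij})` is a listing of `lam` and the `μ_i` are pairwise
distinct. The bijection `e` only numbers the basis; up to similarity its choice is irrelevant. -/
def matrixBundle {n : ℕ} (lam : DoublePartition n) : Set (Matrix (Fin n) (Fin n) ℂ) :=
  {A | ∃ (k : ℕ) (l : Fin k → ℕ) (b : (i : Fin k) → Fin (l i) → ℕ) (μ : Fin k → ℂ)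
      (e : (Σ i, Σ j, Fin (b i j)) ≃ Fin n) (S : Matrix.GeneralLinearGroup (Fin n) ℂ),
      lam.parts = Finset.univ.val.map (fun i => Finset.univ.val.map (b i)) ∧
      Function.Injective μ ∧
      (↑S⁻¹ : Matrix (Fin n) (Fin n) ℂ) * A * (↑S : Matrix (Fin n) (Fin n) ℂ) =
        Matrix.reindex e e (jordanForm b μ)}

/-- A matrix-valued map on a complex manifold `X` (modelled on `E`) is holomorphic on `U`: all
its entries are complex differentiable on `U`. -/
def HolomorphicMatrixOn (E : Type*) [NormedAddCommGroup E] [NormedSpace ℂ E]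
    {X : Type*} [TopologicalSpace X] [ChartedSpace E X] {n : ℕ}
    (A : X → Matrix (Fin n) (Fin n) ℂ) (U : Set X) : Prop :=
  ∀ i j, MDifferentiableOn 𝓘(ℂ, E) 𝓘(ℂ, ℂ) (fun x => A x i j) U

/-- `A` is locally holomorphically Jordanizable at `x₀`: on some open neighbourhood `U` of `x₀`
there is a holomorphic `S : U → GL(n, ℂ)` such that `S(x)⁻¹ A(x) S(x)` is a Jordan matrix for all
`x ∈ U`. (Values of `S` outside `U` play no role.) -/
def LocallyHolomorphicallyJordanizableAt (E : Type*) [NormedAddCommGroup E] [NormedSpace ℂ E]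
    {X : Type*} [TopologicalSpace X] [ChartedSpace E X] {n : ℕ}
    (A : X → Matrix (Fin n) (Fin n) ℂ) (x₀ : X) : Prop :=
  ∃ U : Set X, IsOpen U ∧ x₀ ∈ U ∧
    ∃ S : X → Matrix.GeneralLinearGroup (Fin n) ℂ,
      HolomorphicMatrixOn E (fun x => (↑(S x) : Matrix (Fin n) (Fin n) ℂ)) U ∧
      ∀ x ∈ U, IsJordanMatrix
        ((↑(S x)⁻¹ : Matrix (Fin n) (Fin n) ℂ) * A x * (↑(S x) : Matrix (Fin n) (Fin n) ℂ))

end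

/-! On a bundle, the number `k` of distinct eigenvalues and, for each `p`, the sum over them of dim
ker (A - μ)^p depend only on `lam`. Each eigenvalue at the base point keeps an eigenvalue near it,
and since there are always exactly `k`, this singles out `k` continuous branches μ_i. Nullity is
upper semicontinuous, so constancy of the sum forces each dim ker (A - μ_i)^p to be locally constant
(`exists_differentiable_eigenvalues`). It is thus unnecessary to know which part of `lam` belongs to
which branch.

For `p = n` this dimension is the algebraic multiplicity. A continuous root of constant multiplicity
N + 1 is a simple root of the N-th derivative of the characteristic polynomial, hence holomorphic
(`differentiableAt_of_rootMultiplicity_eq`).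

When the kernels of a holomorphic matrix family have constant dimension, every kernel vector at the
base point extends to a holomorphic section (`exists_kernel_section`). A Jordan basis there is
generated by one vector per block, lying in ker (A - μ_i)^b for a block of size b. Extending these
vectors and applying powers of A - μ_i gives a holomorphic P with AP = PJ (`mul_chainMatrix`), where
J has fixed block sizes and varying eigenvalues. P is invertible at the base point, hence near it.
-/

/-! ### Nullity of a square matrix -/

/-- The dimension of the kernel of a square matrix. -/
noncomputable def nullity {m : Type*} [Fintype m] (M : Matrix m m ℂ) : ℕ :=
  Module.finrank ℂ (LinearMap.ker M.mulVecLin)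

section Nullity

variable {m : Type*} [Fintype m]

theorem rank_add_nullity (M : Matrix m m ℂ) : M.rank + nullity M = Fintype.card m := by
  have := LinearMap.finrank_range_add_finrank_ker M.mulVecLin
  rwa [Module.finrank_fintype_fun_eq_card] at this

theorem nullity_reindex {p : Type*} [Fintype p] (e : m ≃ p) (M : Matrix m m ℂ) :
    nullity (Matrix.reindex e e M) = nullity M := by
  classical
  have h1 := rank_add_nullity M
  have h2 := rank_add_nullity (Matrix.reindex e e M)
  rw [Matrix.rank_reindex, ← Fintype.card_congr e] at h2
  omega

variable [DecidableEq m]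

theorem nullity_conj (S : Matrix.GeneralLinearGroup m ℂ) (M : Matrix m m ℂ) :
    nullity ((↑S⁻¹ : Matrix m m ℂ) * M * (↑S : Matrix m m ℂ)) = nullity M := by
  have h1 := rank_add_nullity M
  have h2 := rank_add_nullity ((↑S⁻¹ : Matrix m m ℂ) * M * (↑S : Matrix m m ℂ))
  rw [Matrix.rank_mul_eq_left_of_isUnit_det _ _ ((Matrix.isUnit_iff_isUnit_det _).1 S.isUnit),
    Matrix.rank_mul_eq_right_of_isUnit_det _ _
      ((Matrix.isUnit_iff_isUnit_det _).1 S⁻¹.isUnit)] at h2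
  omega

theorem nullity_eq_zero_iff (M : Matrix m m ℂ) : nullity M = 0 ↔ M.det ≠ 0 := by
  rw [nullity, Submodule.finrank_eq_zero, LinearMap.ker_eq_bot, ← isUnit_iff_ne_zero,
    ← Matrix.isUnit_iff_isUnit_det]
  exact Matrix.mulVec_injective_iff_isUnit

theorem nullity_blockDiagonal' {o : Type*} [Fintype o] [DecidableEq o] {d : o → Type*}
    [∀ i, Fintype (d i)] [∀ i, DecidableEq (d i)] (M : ∀ i, Matrix (d i) (d i) ℂ) :
    nullity (Matrix.blockDiagonal' M) = ∑ i, nullity (M i) := by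
  have key : ∀ (v : (Σ i, d i) → ℂ) i a,
      (Matrix.blockDiagonal' M).mulVec v ⟨i, a⟩ = (M i).mulVec (fun c => v ⟨i, c⟩) a := by
    intro v i a
    simp only [Matrix.mulVec, dotProduct, Fintype.sum_sigma]
    rw [Finset.sum_eq_single i]
    · simp [Matrix.blockDiagonal'_apply_eq]
    · intro j _ hj
      simp [Matrix.blockDiagonal'_apply_ne M _ _ hj.symm]
    · simp
  let φ : LinearMap.ker (Matrix.blockDiagonal' M).mulVecLin ≃ₗ[ℂ]
      (∀ i, LinearMap.ker (M i).mulVecLin) :=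
    { toFun := fun v i => ⟨fun a => v.1 ⟨i, a⟩, by
        have hv := v.2
        rw [LinearMap.mem_ker] at hv ⊢
        ext a
        have := congrFun hv ⟨i, a⟩
        rw [Matrix.mulVecLin_apply, key] at this
        exact this⟩
      map_add' := fun _ _ => rfl
      map_smul' := fun _ _ => rfl
      invFun := fun w => ⟨fun s => (w s.1).1 s.2, by
        rw [LinearMap.mem_ker]
        ext ⟨i, a⟩
        rw [Matrix.mulVecLin_apply, key]
        exact congrFun (LinearMap.mem_ker.1 (w i).2) a⟩
      left_inv := fun _ => rfl
      right_inv := fun _ => rfl }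
  rw [nullity, φ.finrank_eq, Module.finrank_pi_fintype]
  rfl

end Nullity

/-! ### Jordan blocks and the bundle of a double partition -/

theorem jordanBlock_sub (h : ℕ) (μ c : ℂ) :
    jordanBlock h μ - c • (1 : Matrix (Fin h) (Fin h) ℂ) = jordanBlock h (μ - c) := by
  ext i j
  by_cases hij : i = j
  · simp [jordanBlock, hij]
  · simp [jordanBlock, hij]

theorem det_jordanBlock (h : ℕ) (μ : ℂ) : (jordanBlock h μ).det = μ ^ h := by
  rw [Matrix.det_of_isUpperTriangular]
  · simp [jordanBlock]
  · intro i j hij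
    have h1 : j < i := hij
    have h2 : ¬ (i : ℕ) + 1 = j := by have := Fin.lt_def.1 h1; omega
    simp [jordanBlock, h1.ne', h2]

theorem nullity_jordanBlock_pow_of_ne_zero (h p : ℕ) {μ : ℂ} (hμ : μ ≠ 0) :
    nullity (jordanBlock h μ ^ p) = 0 := by
  rw [nullity_eq_zero_iff, Matrix.det_pow, det_jordanBlock]
  exact pow_ne_zero _ (pow_ne_zero _ hμ)

theorem jordanForm_sub_pow {k : ℕ} {l : Fin k → ℕ} (b : (i : Fin k) → Fin (l i) → ℕ)
    (μ : Fin k → ℂ) (c : ℂ) (p : ℕ) :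
    (jordanForm b μ - c • (1 : Matrix _ _ ℂ)) ^ p =
      Matrix.blockDiagonal' fun i => Matrix.blockDiagonal' fun j =>
        jordanBlock (b i j) (μ i - c) ^ p := by
  have h1 : (c • (1 : Matrix (Σ i, Σ j, Fin (b i j)) (Σ i, Σ j, Fin (b i j)) ℂ)) =
      Matrix.blockDiagonal' fun i => Matrix.blockDiagonal' fun j =>
        c • (1 : Matrix (Fin (b i j)) (Fin (b i j)) ℂ) := by
    rw [← Matrix.blockDiagonal'_one, ← Matrix.blockDiagonal'_smul]
    congr 1
    funext i
    simp only [Pi.smul_apply, Pi.one_apply]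
    rw [← Matrix.blockDiagonal'_one, ← Matrix.blockDiagonal'_smul]
    rfl
  rw [h1, jordanForm, ← Matrix.blockDiagonal'_sub, ← Matrix.blockDiagonal'_pow]
  congr 1
  funext i
  simp only [Pi.pow_apply, Pi.sub_apply]
  rw [← Matrix.blockDiagonal'_sub, ← Matrix.blockDiagonal'_pow]
  congr 1
  funext j
  simp only [Pi.pow_apply, Pi.sub_apply]
  rw [jordanBlock_sub]

theorem nullity_jordanForm_sub_pow {k : ℕ} {l : Fin k → ℕ} (b : (i : Fin k) → Fin (l i) → ℕ)
    (μ : Fin k → ℂ) (c : ℂ) (p : ℕ) :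
    nullity ((jordanForm b μ - c • (1 : Matrix _ _ ℂ)) ^ p) =
      ∑ i, ∑ j, nullity (jordanBlock (b i j) (μ i - c) ^ p) := by
  rw [jordanForm_sub_pow, nullity_blockDiagonal']
  simp_rw [nullity_blockDiagonal']

theorem conj_sub_smul_one_pow {n : ℕ} (S : Matrix.GeneralLinearGroup (Fin n) ℂ)
    (A : Matrix (Fin n) (Fin n) ℂ) (c : ℂ) (p : ℕ) :
    (↑S⁻¹ : Matrix (Fin n) (Fin n) ℂ) * (A - c • 1) ^ p * (↑S : Matrix (Fin n) (Fin n) ℂ) =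
      ((↑S⁻¹ : Matrix (Fin n) (Fin n) ℂ) * A * (↑S : Matrix (Fin n) (Fin n) ℂ) - c • 1) ^ p := by
  rw [← Units.conj_pow' S]
  congr 1
  rw [mul_sub, sub_mul, mul_smul_comm, mul_one, smul_mul_assoc, Units.inv_mul]

theorem reindex_sub_smul_one_pow {n : ℕ} {m : Type*} [Fintype m] [DecidableEq m]
    (e : m ≃ Fin n) (M : Matrix m m ℂ) (c : ℂ) (p : ℕ) :
    (Matrix.reindex e e M - c • (1 : Matrix (Fin n) (Fin n) ℂ)) ^ p =
      Matrix.reindex e e ((M - c • (1 : Matrix m m ℂ)) ^ p) := by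
  have := map_pow (Matrix.reindexAlgEquiv ℂ ℂ e) (M - c • (1 : Matrix m m ℂ)) p
  rw [map_sub, map_smul, map_one] at this
  exact this.symm

/-- The sum over all eigenvalues `c` of `dim ker (A - c) ^ p`, for `A` in the bundle of `lam`. -/
noncomputable def DoublePartition.kernelDimSum {n : ℕ} (lam : DoublePartition n) (p : ℕ) : ℕ :=
  (lam.parts.map fun P => (P.map fun h => nullity (jordanBlock h 0 ^ p)).sum).sum

theorem nullity_sub_pow_of_conj_eq_jordanForm {n k : ℕ} {l : Fin k → ℕ}
    {b : (i : Fin k) → Fin (l i) → ℕ} {μ : Fin k → ℂ}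
    {e : (Σ i, Σ j, Fin (b i j)) ≃ Fin n} {S : Matrix.GeneralLinearGroup (Fin n) ℂ}
    {A : Matrix (Fin n) (Fin n) ℂ}
    (hS : (↑S⁻¹ : Matrix (Fin n) (Fin n) ℂ) * A * (↑S : Matrix (Fin n) (Fin n) ℂ) =
        Matrix.reindex e e (jordanForm b μ)) (c : ℂ) (p : ℕ) :
    nullity ((A - c • 1) ^ p) = ∑ i, ∑ j, nullity (jordanBlock (b i j) (μ i - c) ^ p) := by
  rw [← nullity_conj S, conj_sub_smul_one_pow, hS, reindex_sub_smul_one_pow, nullity_reindex,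
    nullity_jordanForm_sub_pow]

theorem nullity_sub_pow_eq_of_conj_eq_jordanForm {n k : ℕ} {l : Fin k → ℕ}
    {b : (i : Fin k) → Fin (l i) → ℕ} {μ : Fin k → ℂ} (hμ : Function.Injective μ)
    {e : (Σ i, Σ j, Fin (b i j)) ≃ Fin n} {S : Matrix.GeneralLinearGroup (Fin n) ℂ}
    {A : Matrix (Fin n) (Fin n) ℂ}
    (hS : (↑S⁻¹ : Matrix (Fin n) (Fin n) ℂ) * A * (↑S : Matrix (Fin n) (Fin n) ℂ) =
        Matrix.reindex e e (jordanForm b μ)) (i : Fin k) (p : ℕ) :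
    nullity ((A - μ i • 1) ^ p) = ∑ j, nullity (jordanBlock (b i j) 0 ^ p) := by
  rw [nullity_sub_pow_of_conj_eq_jordanForm hS, Finset.sum_eq_single i]
  · simp
  · intro j _ hj
    exact Finset.sum_eq_zero fun q _ =>
      nullity_jordanBlock_pow_of_ne_zero _ _ (sub_ne_zero.2 (hμ.ne hj))
  · simp

theorem sum_nullity_of_conj_eq_jordanForm {n k : ℕ} {lam : DoublePartition n} {l : Fin k → ℕ}
    {b : (i : Fin k) → Fin (l i) → ℕ} {μ : Fin k → ℂ} (hμ : Function.Injective μ)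
    (hlam : lam.parts = Finset.univ.val.map (fun i => Finset.univ.val.map (b i)))
    {e : (Σ i, Σ j, Fin (b i j)) ≃ Fin n} {S : Matrix.GeneralLinearGroup (Fin n) ℂ}
    {A : Matrix (Fin n) (Fin n) ℂ}
    (hS : (↑S⁻¹ : Matrix (Fin n) (Fin n) ℂ) * A * (↑S : Matrix (Fin n) (Fin n) ℂ) =
        Matrix.reindex e e (jordanForm b μ)) (p : ℕ) :
    ∑ i, nullity ((A - μ i • 1) ^ p) = lam.kernelDimSum p := by
  simp_rw [nullity_sub_pow_eq_of_conj_eq_jordanForm hμ hS]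
  simp only [DoublePartition.kernelDimSum, hlam, Multiset.map_map, Function.comp_def]
  rfl

theorem det_eq_zero_iff_of_conj_eq_jordanForm {n k : ℕ} {lam : DoublePartition n} {l : Fin k → ℕ}
    {b : (i : Fin k) → Fin (l i) → ℕ} {μ : Fin k → ℂ} (hμ : Function.Injective μ)
    (hlam : lam.parts = Finset.univ.val.map (fun i => Finset.univ.val.map (b i)))
    {e : (Σ i, Σ j, Fin (b i j)) ≃ Fin n} {S : Matrix.GeneralLinearGroup (Fin n) ℂ}
    {A : Matrix (Fin n) (Fin n) ℂ}
    (hS : (↑S⁻¹ : Matrix (Fin n) (Fin n) ℂ) * A * (↑S : Matrix (Fin n) (Fin n) ℂ) =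
        Matrix.reindex e e (jordanForm b μ)) (c : ℂ) :
    (A - c • 1).det = 0 ↔ c ∈ Set.range μ := by
  rw [← not_iff_not, ← ne_eq, ← nullity_eq_zero_iff, ← pow_one (A - c • 1)]
  constructor
  · rintro h ⟨i, rfl⟩
    rw [nullity_sub_pow_eq_of_conj_eq_jordanForm hμ hS, Finset.sum_eq_zero_iff] at h
    -- The part is nonempty and its members are positive, so `μ i` owns a block of positive size,
    -- which is singular at `μ i`.
    have hi : Finset.univ.val.map (b i) ∈ lam.parts := by
      rw [hlam]
      exact Multiset.mem_map_of_mem _ (Finset.mem_univ_val i)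
    obtain ⟨q, hq⟩ := Multiset.exists_mem_of_ne_zero (lam.ne_zero _ hi)
    have hpos := lam.pos _ hi q hq
    obtain ⟨j, -, rfl⟩ := Multiset.mem_map.1 hq
    have := h j (Finset.mem_univ j)
    rw [pow_one, nullity_eq_zero_iff, det_jordanBlock] at this
    exact this (zero_pow hpos.ne')
  · intro h
    rw [nullity_sub_pow_of_conj_eq_jordanForm hS]
    exact Finset.sum_eq_zero fun i _ => Finset.sum_eq_zero fun j _ =>
      nullity_jordanBlock_pow_of_ne_zero _ _ (sub_ne_zero.2 fun hc => h ⟨i, hc⟩)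

/-- Every matrix in a bundle has the same number of distinct eigenvalues, and the same sum of
the dimensions of the kernels of the `p`-th powers. -/
theorem exists_eigenvalues_of_mem_matrixBundle {n k : ℕ} {lam : DoublePartition n}
    (hk : lam.parts.card = k) {A : Matrix (Fin n) (Fin n) ℂ} (hA : A ∈ matrixBundle lam) :
    ∃ μ : Fin k → ℂ, Function.Injective μ ∧ (∀ c, (A - c • 1).det = 0 ↔ c ∈ Set.range μ) ∧
      ∀ p, ∑ i, nullity ((A - μ i • 1) ^ p) = lam.kernelDimSum p := by
  obtain ⟨k', l, b, μ, e, S, hlam, hμ, hS⟩ := hA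
  obtain rfl : k' = k := by rw [← hk, hlam]; simp
  exact ⟨μ, hμ, det_eq_zero_iff_of_conj_eq_jordanForm hμ hlam hS,
    sum_nullity_of_conj_eq_jordanForm hμ hlam hS⟩

/-! ### Semicontinuity of the nullity and kernel sections -/

section Kernel

open Filter Topology

variable {m : Type*} [Fintype m] [DecidableEq m]

/-- `C` kills a complement of ker M and carries ker M isomorphically onto a complement of the range,
so nothing cancels in M + C. The same `C` still works for matrices near M. -/
theorem exists_rank_eq_nullity_and_isUnit_add (M : Matrix m m ℂ) :
    ∃ C : Matrix m m ℂ, C.rank = nullity M ∧ IsUnit (M + C) := by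
  set f := M.mulVecLin with hf
  obtain ⟨R', hR⟩ := (LinearMap.range f).exists_isCompl
  obtain ⟨K', hK⟩ := (LinearMap.ker f).exists_isCompl
  have hdim : Module.finrank ℂ (LinearMap.ker f) = Module.finrank ℂ R' := by
    have h1 := LinearMap.finrank_range_add_finrank_ker f
    have h2 := Submodule.finrank_add_eq_of_isCompl hR
    omega
  let g : LinearMap.ker f ≃ₗ[ℂ] R' := LinearEquiv.ofFinrankEq _ _ hdim
  let π := (LinearMap.ker f).projectionOnto K' hK
  let C : (m → ℂ) →ₗ[ℂ] (m → ℂ) := R'.subtype ∘ₗ g.toLinearMap ∘ₗ π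
  have hC : (LinearMap.toMatrix' C).mulVecLin = C := by
    rw [← Matrix.toLin'_apply', Matrix.toLin'_toMatrix']
  refine ⟨LinearMap.toMatrix' C, ?_, ?_⟩
  · have hr : LinearMap.range C = R' := by
      have h1 : Function.Surjective (g.toLinearMap ∘ₗ π) :=
        g.surjective.comp (Submodule.projectionOnto_surjective hK)
      rw [LinearMap.range_comp_of_range_eq_top _ (LinearMap.range_eq_top.2 h1),
        Submodule.range_subtype]
    rw [Matrix.rank, hC, hr, nullity, ← hdim]
  · rw [← Matrix.mulVec_injective_iff_isUnit]
    have hinj : Function.Injective (M + LinearMap.toMatrix' C).mulVecLin := by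
      rw [injective_iff_map_eq_zero]
      intro v hv
      rw [Matrix.mulVecLin_add, LinearMap.add_apply, hC, ← hf] at hv
      have h1 : f v ∈ R' := by
        rw [eq_neg_of_add_eq_zero_left hv]
        exact R'.neg_mem (g (π v)).2
      have h2 : f v = 0 := by
        have := hR.disjoint.le_bot ⟨LinearMap.mem_range_self f v, h1⟩
        simpa using this
      rw [h2, zero_add] at hv
      have h3 : g (π v) = 0 := Subtype.ext hv
      have h4 : π v = 0 := by simpa using h3
      have h5 : π v = ⟨v, h2⟩ := Submodule.projectionOnto_apply_left hK ⟨v, h2⟩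
      exact congrArg Subtype.val (h5.symm.trans h4)
    exact hinj

/-- On ker M the maps M + C and C agree. -/
theorem map_ker_le_range {m : Type*} [Fintype m] {M C : Matrix m m ℂ} :
    (LinearMap.ker M.mulVecLin).map (M + C).mulVecLin ≤ LinearMap.range C.mulVecLin := by
  rintro _ ⟨v, hv, rfl⟩
  refine ⟨v, ?_⟩
  rw [Matrix.mulVecLin_add, LinearMap.add_apply, LinearMap.mem_ker.1 hv, zero_add]

theorem finrank_map_ker {M C : Matrix m m ℂ} (h : IsUnit (M + C)) :
    Module.finrank ℂ ((LinearMap.ker M.mulVecLin).map (M + C).mulVecLin) = nullity M :=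
  (Submodule.equivMapOfInjective (M + C).mulVecLin
    (Matrix.mulVec_injective_iff_isUnit.2 h) _).finrank_eq.symm

theorem nullity_le_rank {M C : Matrix m m ℂ} (h : IsUnit (M + C)) : nullity M ≤ C.rank :=
  (finrank_map_ker h).symm.le.trans (Submodule.finrank_mono map_ker_le_range)

/-- Equal dimensions turn the inclusion of (M + C)(ker M) in range C into an equality, so the
inverse of M + C carries range C back onto ker M. This parametrizes the kernel by a formula
holomorphic in M. -/
theorem mulVec_inv_mulVec_eq_zero {M C : Matrix m m ℂ} (h : IsUnit (M + C))
    (hr : nullity M = C.rank) (v : m → ℂ) :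
    M.mulVec ((M + C)⁻¹.mulVec (C.mulVec v)) = 0 := by
  have heq := Submodule.eq_of_le_of_finrank_eq (map_ker_le_range (M := M) (C := C))
    ((finrank_map_ker h).trans hr)
  have hv : C.mulVec v ∈ LinearMap.range C.mulVecLin := ⟨v, rfl⟩
  rw [← heq] at hv
  obtain ⟨u, hu, huv⟩ := hv
  rw [Matrix.mulVecLin_apply] at huv
  rw [← huv, Matrix.mulVec_mulVec (v := u),
    Matrix.nonsing_inv_mul _ ((Matrix.isUnit_iff_isUnit_det _).1 h), Matrix.one_mulVec]
  exact LinearMap.mem_ker.1 hu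

theorem eventually_isUnit {Y : Type*} [TopologicalSpace Y] {M : Y → Matrix m m ℂ} {y₀ : Y}
    (hM : ContinuousAt M y₀) (h : IsUnit (M y₀)) : ∀ᶠ y in 𝓝 y₀, IsUnit (M y) := by
  have hdet : ContinuousAt (fun y => (M y).det) y₀ :=
    (Continuous.matrix_det continuous_id).continuousAt.comp hM
  have := hdet.eventually_ne ((Matrix.isUnit_iff_isUnit_det _).1 h).ne_zero
  filter_upwards [this] with y hy
  exact (Matrix.isUnit_iff_isUnit_det _).2 hy.isUnit

theorem eventually_nullity_le {Y : Type*} [TopologicalSpace Y] {M : Y → Matrix m m ℂ} {y₀ : Y}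
    (hM : ContinuousAt M y₀) : ∀ᶠ y in 𝓝 y₀, nullity (M y) ≤ nullity (M y₀) := by
  obtain ⟨C, hC, hu⟩ := exists_rank_eq_nullity_and_isUnit_add (M y₀)
  filter_upwards [eventually_isUnit (hM.add continuousAt_const) hu] with y hy
  exact hC ▸ nullity_le_rank hy

end Kernel

/-! ### Entrywise complex differentiability of matrix-valued maps -/

section Differentiability

open Filter Topology

variable {E : Type*} [NormedAddCommGroup E] [NormedSpace ℂ E]
  {m p q : Type*}

/-- Entrywise complex differentiability at a point of a matrix-valued map. -/
def EntriesDifferentiableAt (M : E → Matrix p q ℂ) (y : E) : Prop :=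
  ∀ i j, DifferentiableAt ℂ (fun x => M x i j) y

theorem EntriesDifferentiableAt.continuousAt {M : E → Matrix p q ℂ} {y : E}
    (h : EntriesDifferentiableAt M y) : ContinuousAt M y :=
  continuousAt_pi.2 fun i => continuousAt_pi.2 fun j => (h i j).continuousAt

theorem EntriesDifferentiableAt.const (C : Matrix p q ℂ) (y : E) :
    EntriesDifferentiableAt (fun _ => C) y :=
  fun _ _ => differentiableAt_const _

theorem EntriesDifferentiableAt.add {M N : E → Matrix p q ℂ} {y : E}
    (hM : EntriesDifferentiableAt M y) (hN : EntriesDifferentiableAt N y) :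
    EntriesDifferentiableAt (fun x => M x + N x) y :=
  fun i j => (hM i j).add (hN i j)

theorem EntriesDifferentiableAt.mul [Fintype m] {M : E → Matrix p m ℂ} {N : E → Matrix m q ℂ}
    {y : E} (hM : EntriesDifferentiableAt M y) (hN : EntriesDifferentiableAt N y) :
    EntriesDifferentiableAt (fun x => M x * N x) y := by
  intro i j
  simp only [Matrix.mul_apply]
  exact DifferentiableAt.fun_sum fun k _ => (hM i k).mul (hN k j)

theorem EntriesDifferentiableAt.mulVec [Fintype m] {M : E → Matrix p m ℂ} {w : E → m → ℂ}
    {y : E} (hM : EntriesDifferentiableAt M y) (hw : ∀ i, DifferentiableAt ℂ (fun x => w x i) y)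
    (i : p) : DifferentiableAt ℂ (fun x => (M x).mulVec (w x) i) y := by
  simp only [Matrix.mulVec, dotProduct]
  exact DifferentiableAt.fun_sum fun k _ => (hM i k).mul (hw k)

variable [DecidableEq m]

theorem EntriesDifferentiableAt.sub_smul_one {M : E → Matrix m m ℂ} {c : E → ℂ}
    {y : E} (hM : EntriesDifferentiableAt M y) (hc : DifferentiableAt ℂ c y) :
    EntriesDifferentiableAt (fun x => M x - c x • (1 : Matrix m m ℂ)) y :=
  fun i j => (hM i j).sub (hc.mul_const _)

variable [Fintype m]

theorem EntriesDifferentiableAt.pow {M : E → Matrix m m ℂ}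
    {y : E} (hM : EntriesDifferentiableAt M y) (k : ℕ) :
    EntriesDifferentiableAt (fun x => M x ^ k) y := by
  induction k with
  | zero => simpa using EntriesDifferentiableAt.const 1 y
  | succ k ih => simpa only [pow_succ] using ih.mul hM

theorem EntriesDifferentiableAt.det {M : E → Matrix m m ℂ}
    {y : E} (hM : EntriesDifferentiableAt M y) : DifferentiableAt ℂ (fun x => (M x).det) y := by
  simp only [Matrix.det_apply]
  refine DifferentiableAt.fun_sum fun σ _ => DifferentiableAt.const_smul ?_ _
  generalize (Finset.univ : Finset m) = s
  induction s using Finset.cons_induction with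
  | empty => simp
  | cons a s ha ih =>
    simp only [Finset.prod_cons]
    exact (hM (σ a) a).mul ih

theorem EntriesDifferentiableAt.inv {M : E → Matrix m m ℂ} {y : E}
    (hM : EntriesDifferentiableAt M y) (hu : IsUnit (M y)) :
    EntriesDifferentiableAt (fun x => (M x)⁻¹) y := by
  intro i j
  simp only [Matrix.inv_def, Matrix.smul_apply, Ring.inverse_eq_inv, smul_eq_mul,
    Matrix.adjugate_apply]
  refine (hM.det.inv ((Matrix.isUnit_iff_isUnit_det _).1 hu).ne_zero).mul ?_
  refine EntriesDifferentiableAt.det fun a b => ?_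
  simp only [Matrix.updateRow_apply]
  split_ifs
  · exact differentiableAt_const _
  · exact hM a b

/-- A vector in the kernel of `M y₀` extends to a holomorphic section of the kernels of `M y`,
provided that these have constant dimension. -/
theorem exists_kernel_section {M : E → Matrix m m ℂ} {y₀ : E}
    (hM : ∀ᶠ y in 𝓝 y₀, EntriesDifferentiableAt M y)
    (hn : ∀ᶠ y in 𝓝 y₀, nullity (M y) = nullity (M y₀)) {v : m → ℂ}
    (hv : (M y₀).mulVec v = 0) :
    ∃ w : E → m → ℂ, w y₀ = v ∧
      ∀ᶠ y in 𝓝 y₀, (∀ i, DifferentiableAt ℂ (fun x => w x i) y) ∧ (M y).mulVec (w y) = 0 := by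
  obtain ⟨C, hC, hu⟩ := exists_rank_eq_nullity_and_isUnit_add (M y₀)
  refine ⟨fun y => (M y + C)⁻¹.mulVec (C.mulVec v), ?_, ?_⟩
  -- At `y₀` the section returns `v`, because M v = 0 makes C v equal to (M + C) v.
  · have : C.mulVec v = (M y₀ + C).mulVec v := by rw [Matrix.add_mulVec, hv, zero_add]
    simp only [this]
    rw [Matrix.mulVec_mulVec, Matrix.nonsing_inv_mul _ ((Matrix.isUnit_iff_isUnit_det _).1 hu),
      Matrix.one_mulVec]
  · have hMC : ContinuousAt (fun y => M y + C) y₀ :=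
      hM.self_of_nhds.continuousAt.add continuousAt_const
    filter_upwards [hM, hn, eventually_isUnit hMC hu] with y h1 h2 h3
    exact ⟨fun i => ((h1.add (.const C y)).inv h3).mulVec (fun j => differentiableAt_const (C.mulVec v j)) i,
      mulVec_inv_mulVec_eq_zero h3 (h2.trans hC.symm) v⟩

end Differentiability

/-! ### Continuity and differentiability of roots -/

section Eigenvalues

open Polynomial Filter Topology

/-- Since f vanishes at y, f(x)(h(x) - h(y)) is O(x - y) times o(1), so its derivative at y is zero;
the remainder is f times a constant. -/
theorem DifferentiableAt.mul_continuousAt_of_eq_zero {E : Type*} [NormedAddCommGroup E]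
    [NormedSpace ℂ E] {f h : E → ℂ} {y : E} (hf : DifferentiableAt ℂ f y) (hy : f y = 0)
    (hh : ContinuousAt h y) : DifferentiableAt ℂ (fun x => f x * h x) y := by
  have h1 : DifferentiableAt ℂ (fun x => f x * (h x - h y)) y := by
    refine HasFDerivAt.differentiableAt (f' := 0) (.of_isLittleO ?_)
    have h2 : (fun x => f x) =O[𝓝 y] fun x => x - y := by
      simpa [hy] using hf.hasFDerivAt.isBigO_sub
    have h3 : (fun x => h x - h y) =o[𝓝 y] fun _ => (1 : ℝ) := by
      rw [Asymptotics.isLittleO_one_iff]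
      exact (sub_self (h y)) ▸ (hh.tendsto.sub_const (h y))
    have h4 := h2.norm_right.mul_isLittleO h3
    simp only [mul_one] at h4
    simpa [hy] using h4.of_norm_right
  refine (h1.add (hf.mul_const (h y))).congr_of_eventuallyEq (.of_forall fun x => ?_)
  simp only [Pi.add_apply]
  ring

/-- With q(x) the divided difference of P_x between c(x) and c(y), the root equation reads c(x) =
c(y) - P_x(c(y)) / q(x). Here q is merely continuous, with q(y) = P_y'(c(y)) ≠ 0, but the numerator
is differentiable and vanishes at y, so the preceding lemma applies. -/
theorem differentiableAt_root_of_continuousAt {E : Type*} [NormedAddCommGroup E]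
    [NormedSpace ℂ E] {P : E → ℂ[X]} {c : E → ℂ} {y : E} (d : ℕ)
    (hd : ∀ x, (P x).natDegree ≤ d) (hP : ∀ j, DifferentiableAt ℂ (fun x => (P x).coeff j) y)
    (hc : ContinuousAt c y) (hroot : ∀ᶠ x in 𝓝 y, (P x).eval (c x) = 0)
    (hsimple : (derivative (P y)).eval (c y) ≠ 0) : DifferentiableAt ℂ c y := by
  have heval : ∀ x t, (P x).eval t = ∑ j ∈ Finset.range (d + 1), (P x).coeff j * t ^ j :=
    fun x t => eval_eq_sum_range' (Nat.lt_succ_of_le (hd x)) t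
  let q : E → ℂ := fun x => ∑ j ∈ Finset.range (d + 1), (P x).coeff j *
    ∑ i ∈ Finset.range j, c x ^ i * c y ^ (j - 1 - i)
  have hq : ∀ x, q x * (c x - c y) = (P x).eval (c x) - (P x).eval (c y) := by
    intro x
    simp only [q, heval, Finset.sum_mul, ← Finset.sum_sub_distrib]
    refine Finset.sum_congr rfl fun j _ => ?_
    rw [mul_assoc, geom_sum₂_mul, mul_sub]
  have hqc : ContinuousAt q y := by
    refine tendsto_finsetSum _ fun j _ => (hP j).continuousAt.mul ?_
    exact tendsto_finsetSum _ fun i _ => (hc.pow i).mul continuousAt_const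
  have hqy : q y ≠ 0 := by
    convert hsimple using 1
    rw [derivative_eval, sum_over_range' _ (by simp) (d + 1) (Nat.lt_succ_of_le (hd y))]
    refine Finset.sum_congr rfl fun j _ => ?_
    rw [mul_assoc]
    congr 1
    rw [Finset.sum_congr rfl (g := fun _ => c y ^ (j - 1))]
    · simp
    · intro i hi
      rw [← pow_add]
      congr 1
      have := Finset.mem_range.1 hi
      omega
  have hf : DifferentiableAt ℂ (fun x => (P x).eval (c y)) y := by
    simp only [heval]
    exact DifferentiableAt.fun_sum fun j _ => (hP j).mul_const _
  have h1 := hf.mul_continuousAt_of_eq_zero hroot.self_of_nhds (hqc.inv₀ hqy)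
  refine (h1.const_sub (c y)).congr_of_eventuallyEq ?_
  filter_upwards [hroot, hqc.eventually_ne hqy] with x hx hqx
  have := hq x
  rw [hx, zero_sub] at this
  rw [Pi.inv_apply, ← div_eq_mul_inv, eq_sub_iff_add_eq, ← eq_sub_iff_add_eq', div_eq_iff hqx]
  linear_combination this

theorem differentiableAt_coeff_iterate_derivative {E : Type*} [NormedAddCommGroup E]
    [NormedSpace ℂ E] {P : E → ℂ[X]} {y : E}
    (hP : ∀ j, DifferentiableAt ℂ (fun x => (P x).coeff j) y) (k j : ℕ) :
    DifferentiableAt ℂ (fun x => (derivative^[k] (P x)).coeff j) y := by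
  induction k generalizing j with
  | zero => exact hP j
  | succ k ih =>
    simp only [Function.iterate_succ_apply', coeff_derivative]
    exact (ih (j + 1)).mul_const _

theorem differentiableAt_of_rootMultiplicity_eq {E : Type*} [NormedAddCommGroup E]
    [NormedSpace ℂ E] {P : E → ℂ[X]} {c : E → ℂ} {y : E} (d N : ℕ)
    (hd : ∀ x, (P x).natDegree ≤ d) (hP : ∀ j, DifferentiableAt ℂ (fun x => (P x).coeff j) y)
    (hP0 : ∀ x, P x ≠ 0) (hc : ContinuousAt c y)
    (hroot : ∀ᶠ x in 𝓝 y, (P x).rootMultiplicity (c x) = N + 1) : DifferentiableAt ℂ c y := by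
  refine differentiableAt_root_of_continuousAt (P := fun x => derivative^[N] (P x)) d
    (fun x => (natDegree_iterate_derivative _ _).trans (Nat.sub_le_of_le_add
      ((hd x).trans (Nat.le_add_right _ _))))
    (fun j => differentiableAt_coeff_iterate_derivative hP N j) hc ?_ ?_
  · filter_upwards [hroot] with x hx
    exact isRoot_iterate_derivative_of_lt_rootMultiplicity (by omega)
  · intro h
    rw [← Function.iterate_succ_apply' derivative] at h
    have := hroot.self_of_nhds
    -- If the derivative of order N + 1 vanished as well, the multiplicity would exceed N + 1.
    have h2 : N + 1 < (P y).rootMultiplicity (c y) := by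
      rw [lt_rootMultiplicity_iff_isRoot_iterate_derivative (hP0 y)]
      intro m hm
      rcases Nat.lt_or_ge m (N + 1) with h3 | h3
      · exact isRoot_iterate_derivative_of_lt_rootMultiplicity (by omega)
      · obtain rfl : m = N + 1 := by omega
        exact h
    omega

/-- The n-th power already reaches the whole generalized eigenspace. This converts constant nullity
into constant root multiplicity. -/
theorem nullity_sub_pow_eq_rootMultiplicity {n : ℕ} (A : Matrix (Fin n) (Fin n) ℂ) (c : ℂ) :
    nullity ((A - c • 1) ^ n) = A.charpoly.rootMultiplicity c := by
  have h := LinearMap.finrank_maxGenEigenspace_eq (Matrix.toLin' A) c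
  rw [Module.End.maxGenEigenspace_eq_genEigenspace_finrank, Module.finrank_fin_fun,
    Module.End.genEigenspace_nat, Matrix.charpoly_toLin'] at h
  rw [← h, nullity, ← Matrix.toLin'_apply', Matrix.toLin'_pow, map_sub, map_smul,
    Matrix.toLin'_one]
  rfl

/-- det(c - A) is the product of c - r over the n eigenvalues r of A. If all lay at distance at
least ε from c, its norm would be at least ε^n, whereas it tends to 0 as A tends to A₀. -/
theorem exists_eigenvalue_near {n : ℕ} {A₀ : Matrix (Fin n) (Fin n) ℂ} {c : ℂ}
    (hc : (A₀ - c • 1).det = 0) {ε : ℝ} (hε : 0 < ε) :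
    ∀ᶠ A in 𝓝 A₀, ∃ c', (A - c' • (1 : Matrix (Fin n) (Fin n) ℂ)).det = 0 ∧ dist c' c < ε := by
  have hcont : Continuous fun A : Matrix (Fin n) (Fin n) ℂ => (c • 1 - A).det :=
    Continuous.matrix_det (continuous_const.sub continuous_id)
  have h0 : (c • 1 - A₀).det = 0 := by
    rw [← neg_sub, Matrix.det_neg, hc, mul_zero]
  have h1 : ∀ᶠ A in 𝓝 A₀, ‖(c • 1 - A).det‖ < ε ^ n := by
    refine hcont.norm.continuousAt.eventually_lt continuousAt_const ?_
    rw [h0, norm_zero]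
    positivity
  filter_upwards [h1] with A hA
  by_contra! hcon
  have h2 : (c • 1 - A).det = (A.charpoly.roots.map fun r => c - r).prod := by
    have h3 := (IsAlgClosed.splits A.charpoly).eval_eq_prod_roots_of_monic A.charpoly_monic c
    rw [Matrix.eval_charpoly] at h3
    rw [← h3, Matrix.scalar_apply, Matrix.smul_one_eq_diagonal]
  have h3 : A.charpoly.roots.card = n := by
    rw [IsAlgClosed.card_roots_eq_natDegree, Matrix.charpoly_natDegree_eq_dim, Fintype.card_fin]
  replace hA := hA.trans_eq (congrArg (ε ^ ·) h3.symm)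
  rw [h2] at hA
  have h4 : ∀ s : Multiset ℂ, (∀ r ∈ s, ε ≤ dist r c) →
      ε ^ s.card ≤ ‖(s.map fun r => c - r).prod‖ := by
    intro s
    induction s using Multiset.induction_on with
    | empty => simp
    | cons a s ih =>
      intro hs
      rw [Multiset.card_cons, Multiset.map_cons, Multiset.prod_cons, norm_mul, pow_succ']
      refine mul_le_mul ?_ (ih fun r hr => hs r (Multiset.mem_cons_of_mem hr)) (by positivity)
        (norm_nonneg _)
      rw [← dist_eq_norm, dist_comm]
      exact hs a (Multiset.mem_cons_self a s)
  refine absurd (h4 _ fun r hr => hcon r ?_) (not_le.2 hA)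
  have h5 := (mem_roots A.charpoly_monic.ne_zero).1 hr
  rw [IsRoot, Matrix.eval_charpoly, Matrix.scalar_apply, ← Matrix.smul_one_eq_diagonal] at h5
  rw [← neg_sub, Matrix.det_neg, h5, mul_zero]

theorem differentiableAt_coeff_charpoly {E : Type*} [NormedAddCommGroup E]
    [NormedSpace ℂ E] {n : ℕ} {A : E → Matrix (Fin n) (Fin n) ℂ} {y : E}
    (hA : ∀ i j, DifferentiableAt ℂ (fun x => A x i j) y) (k : ℕ) :
    DifferentiableAt ℂ (fun x => (A x).charpoly.coeff k) y := by
  have h1 : ∀ x, (A x).charpoly.coeff k = MvPolynomial.eval (fun ij => A x ij.1 ij.2)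
      ((Matrix.charpoly.univ ℂ (Fin n)).coeff k) := by
    intro x
    have := Matrix.charpoly.univ_coeff_eval₂Hom (R := ℂ) (Fin n) (RingHom.id ℂ)
      (fun ij => A x ij.1 ij.2) k
    exact this.symm
  simp only [h1]
  generalize (Matrix.charpoly.univ ℂ (Fin n)).coeff k = f
  induction f using MvPolynomial.induction_on with
  | C a => simp
  | add p q hp hq => simpa only [map_add] using hp.fun_add hq
  | mul_X p ij hp => simpa only [map_mul, MvPolynomial.eval_X] using hp.fun_mul (hA ij.1 ij.2)

/-- By counting, any k distinct eigenvalues are all of them, so the listing is a permutation of the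
one provided by the bundle. -/
theorem sum_nullity_of_injective_eigenvalues {n k : ℕ} {lam : DoublePartition n}
    (hk : lam.parts.card = k) {A : Matrix (Fin n) (Fin n) ℂ} (hA : A ∈ matrixBundle lam)
    {μ : Fin k → ℂ} (hinj : Function.Injective μ) (hμ : ∀ i, (A - μ i • 1).det = 0) :
    (∀ c, (A - c • 1).det = 0 ↔ c ∈ Set.range μ) ∧
      ∀ p, ∑ i, nullity ((A - μ i • 1) ^ p) = lam.kernelDimSum p := by
  obtain ⟨ν, -, hν, hsum⟩ := exists_eigenvalues_of_mem_matrixBundle hk hA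
  choose σ hσ using fun i => (hν (μ i)).1 (hμ i)
  have hσinj : Function.Injective σ := fun i j hij => hinj (by rw [← hσ, ← hσ, hij])
  have hσb := Finite.injective_iff_bijective.1 hσinj
  have hrange : Set.range μ = Set.range ν := by
    rw [← funext hσ]
    exact hσb.2.range_comp ν
  refine ⟨fun c => by rw [hν, hrange], fun p => ?_⟩
  rw [← hsum p, ← hσb.sum_comp fun j => nullity ((A - ν j • 1) ^ p)]
  simp_rw [hσ]

/-- Near `y₀`, the eigenvalues of a continuous family in a bundle of matrices can be
listed by continuous functions. -/
theorem exists_continuous_eigenvalues {Y : Type*} [TopologicalSpace Y] {n k : ℕ}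
    {lam : DoublePartition n} (hk : lam.parts.card = k) {A : Y → Matrix (Fin n) (Fin n) ℂ}
    {y₀ : Y} (hA : ∀ᶠ y in 𝓝 y₀, ContinuousAt A y ∧ A y ∈ matrixBundle lam) {μ₀ : Fin k → ℂ}
    (hinj : Function.Injective μ₀) (hμ₀ : ∀ i, (A y₀ - μ₀ i • 1).det = 0) :
    ∃ μ : Fin k → Y → ℂ, (∀ i, μ i y₀ = μ₀ i) ∧ ∀ᶠ y in 𝓝 y₀, (∀ i, ContinuousAt (μ i) y) ∧
      ∀ p, ∑ i, nullity ((A y - μ i y • 1) ^ p) = lam.kernelDimSum p := by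
  -- Any `r` below half of every distance between distinct `μ₀ i` makes the discs disjoint.
  obtain ⟨r, hr, hsep⟩ : ∃ r > 0, ∀ i j z, dist z (μ₀ i) < r → dist z (μ₀ j) < r → i = j := by
    have h1 : ∀ᶠ r in 𝓝[>] (0 : ℝ), ∀ i j, i ≠ j → r + r < dist (μ₀ i) (μ₀ j) := by
      refine eventually_all.2 fun i => eventually_all.2 fun j => ?_
      rcases eq_or_ne i j with hij | hij
      · exact .of_forall fun _ h => absurd hij h
      have hpos := dist_pos.2 (hinj.ne hij)
      have h2 : ContinuousAt (fun r : ℝ => r + r) 0 := by fun_prop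
      have h3 := (h2.eventually_lt (continuousAt_const (y := dist (μ₀ i) (μ₀ j)))
        (by rwa [add_zero])).filter_mono
        (nhdsWithin_le_nhds (s := Set.Ioi 0))
      exact h3.mono fun _ h _ => h
    obtain ⟨r, h2, h3⟩ := (h1.and self_mem_nhdsWithin).exists
    refine ⟨r, h3, fun i j z hi hj => ?_⟩
    by_contra hij
    have := h2 i j hij
    have := dist_triangle_left (μ₀ i) (μ₀ j) z
    linarith
  -- Phrased as an implication so that `ν` is defined for every `y`; its values matter only near
  -- `y₀`.
  have hchoice : ∀ y, ∃ ν : Fin k → ℂ,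
      (∀ i, ∃ c, (A y - c • (1 : Matrix (Fin n) (Fin n) ℂ)).det = 0 ∧ dist c (μ₀ i) < r) →
      ∀ i, (A y - ν i • (1 : Matrix (Fin n) (Fin n) ℂ)).det = 0 ∧ dist (ν i) (μ₀ i) < r := by
    intro y
    by_cases h : ∀ i, ∃ c, (A y - c • (1 : Matrix (Fin n) (Fin n) ℂ)).det = 0 ∧ dist c (μ₀ i) < r
    · choose ν hν using h
      exact ⟨ν, fun _ => hν⟩
    · exact ⟨0, fun h' => absurd h' h⟩
  choose ν hν using hchoice
  have hev : ∀ᶠ y in 𝓝 y₀, ContinuousAt A y ∧ A y ∈ matrixBundle lam ∧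
      ∀ i, (A y - ν y i • (1 : Matrix (Fin n) (Fin n) ℂ)).det = 0 ∧ dist (ν y i) (μ₀ i) < r := by
    have h1 : ∀ᶠ y in 𝓝 y₀, ∀ i,
        ∃ c, (A y - c • (1 : Matrix (Fin n) (Fin n) ℂ)).det = 0 ∧ dist c (μ₀ i) < r :=
      eventually_all.2 fun i =>
        hA.self_of_nhds.1.eventually (exists_eigenvalue_near (hμ₀ i) hr)
    filter_upwards [hA, h1] with y hy h2
    exact ⟨hy.1, hy.2, hν y h2⟩
  have hfacts : ∀ y, A y ∈ matrixBundle lam →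
      (∀ i, (A y - ν y i • (1 : Matrix (Fin n) (Fin n) ℂ)).det = 0 ∧ dist (ν y i) (μ₀ i) < r) →
      (∀ c, (A y - c • 1).det = 0 ↔ c ∈ Set.range (ν y)) ∧
        ∀ p, ∑ i, nullity ((A y - ν y i • 1) ^ p) = lam.kernelDimSum p := by
    intro y hy h
    refine sum_nullity_of_injective_eigenvalues hk hy (fun i j hij => ?_) fun i => (h i).1
    exact hsep i j (ν y i) (h i).2 (hij ▸ (h j).2)
  refine ⟨fun i y => ν y i, fun i => ?_, ?_⟩
  · obtain ⟨-, hmem, hi⟩ := hev.self_of_nhds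
    obtain ⟨j, hj⟩ := ((hfacts y₀ hmem hi).1 (μ₀ i)).1 (hμ₀ i)
    obtain rfl := hsep i j (μ₀ i) (by simpa using hr) (hj ▸ (hi j).2)
    exact hj
  · filter_upwards [hev.eventually_nhds] with y hy
    obtain ⟨hcont, hmem, hi⟩ := hy.self_of_nhds
    refine ⟨fun i => Metric.tendsto_nhds.2 fun ε hε => ?_, (hfacts y hmem hi).2⟩
    -- This radius keeps the nearby eigenvalue inside the disc around `μ₀ i`, so by disjointness it
    -- can only be `ν x i`.
    have hε' : 0 < min ε (r - dist (ν y i) (μ₀ i)) := lt_min hε (sub_pos.2 (hi i).2)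
    filter_upwards [hy, hcont.eventually (exists_eigenvalue_near (hi i).1 hε')]
      with x ⟨_, hxmem, hxi⟩ ⟨c, hc, hdist⟩
    obtain ⟨j, rfl⟩ := ((hfacts x hxmem hxi).1 c).1 hc
    obtain ⟨hd1, hd2⟩ := lt_min_iff.1 hdist
    have h3 : dist (ν x j) (μ₀ i) < r := by
      have := dist_triangle (ν x j) (ν y i) (μ₀ i)
      linarith
    obtain rfl := hsep i j (ν x j) h3 (hxi j).2
    exact hd1

/-- Near `y₀`, the eigenvalues of a holomorphic family in a bundle of matrices can be listed by
holomorphic functions `μ i`, with `dim ker (A - μ i) ^ p` constant. -/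
theorem exists_differentiable_eigenvalues {E : Type*} [NormedAddCommGroup E] [NormedSpace ℂ E]
    {n k : ℕ} {lam : DoublePartition n} (hk : lam.parts.card = k)
    {A : E → Matrix (Fin n) (Fin n) ℂ} {y₀ : E}
    (hA : ∀ᶠ y in 𝓝 y₀, EntriesDifferentiableAt A y ∧ A y ∈ matrixBundle lam) {μ₀ : Fin k → ℂ}
    (hinj : Function.Injective μ₀) (hμ₀ : ∀ i, (A y₀ - μ₀ i • 1).det = 0) :
    ∃ μ : Fin k → E → ℂ, (∀ i, μ i y₀ = μ₀ i) ∧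
      ∀ᶠ y in 𝓝 y₀, (∀ i, DifferentiableAt ℂ (μ i) y) ∧
        ∀ p ≤ n, ∀ i, nullity ((A y - μ i y • 1) ^ p) = nullity ((A y₀ - μ₀ i • 1) ^ p) := by
  obtain ⟨μ, hμ, hev⟩ := exists_continuous_eigenvalues hk
    (hA.mono fun y hy => ⟨hy.1.continuousAt, hy.2⟩) hinj hμ₀
  -- Restricting to p ≤ n leaves finitely many conditions, so one neighbourhood serves them all.
  have hle : ∀ᶠ y in 𝓝 y₀, ∀ p ∈ Finset.range (n + 1), ∀ i,
      nullity ((A y - μ i y • 1) ^ p) ≤ nullity ((A y₀ - μ i y₀ • 1) ^ p) := by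
    rw [Filter.eventually_all_finset]
    intro p _
    refine eventually_all.2 fun i => eventually_nullity_le ?_
    exact (hA.self_of_nhds.1.continuousAt.sub
      ((hev.self_of_nhds.1 i).smul continuousAt_const)).pow p
  have heq : ∀ᶠ y in 𝓝 y₀, ∀ p ≤ n, ∀ i,
      nullity ((A y - μ i y • 1) ^ p) = nullity ((A y₀ - μ₀ i • 1) ^ p) := by
    filter_upwards [hle, hev] with y h1 h2 p hp i
    -- Termwise inequalities between families with equal sums are equalities.
    have h3 := (Finset.sum_eq_sum_iff_of_le fun i _ =>
      h1 p (Finset.mem_range.2 (Nat.lt_succ_of_le hp)) i).1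
      ((h2.2 p).trans (hev.self_of_nhds.2 p).symm)
    rw [h3 i (Finset.mem_univ i), hμ]
  refine ⟨μ, hμ, ?_⟩
  filter_upwards [hA, hev, heq, heq.eventually_nhds] with y h1 h2 h3 h4
  refine ⟨fun i => ?_, h3⟩
  -- The multiplicity is positive because `μ₀ i` is an eigenvalue; for n = 0 the empty determinant
  -- is 1, so no eigenvalue exists.
  obtain ⟨N, hN⟩ : ∃ N, nullity ((A y₀ - μ₀ i • 1) ^ n) = N + 1 := by
    refine Nat.exists_eq_succ_of_ne_zero fun h => ?_
    rw [nullity_eq_zero_iff, Matrix.det_pow, hμ₀ i] at h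
    rcases Nat.eq_zero_or_pos n with rfl | hn
    · simpa using hμ₀ i
    · exact h (zero_pow hn.ne')
  refine differentiableAt_of_rootMultiplicity_eq (P := fun x => (A x).charpoly) n N
    (fun x => by rw [Matrix.charpoly_natDegree_eq_dim, Fintype.card_fin])
    (differentiableAt_coeff_charpoly h1.1) (fun x => (A x).charpoly_monic.ne_zero) (h2.1 i) ?_
  filter_upwards [h4] with x hx
  rw [← nullity_sub_pow_eq_rootMultiplicity, hx n le_rfl i, hN]

end Eigenvalues

/-! ### Jordan chains -/

section JordanChains

variable {n m : ℕ} {b : Fin m → ℕ}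

/-- The matrix whose columns are the Jordan chains
`(A - c q) ^ (b q - 1) w q, …, (A - c q) w q, w q`. -/
noncomputable def chainMatrix (b : Fin m → ℕ) (A : Matrix (Fin n) (Fin n) ℂ) (c : Fin m → ℂ)
    (w : Fin m → Fin n → ℂ) : Matrix (Fin n) (Σ q, Fin (b q)) ℂ :=
  Matrix.of fun r s => ((A - c s.1 • 1) ^ (b s.1 - 1 - s.2)).mulVec (w s.1) r

theorem mul_blockDiagonal'_jordanBlock_apply_zero (P : Matrix (Fin n) (Σ q, Fin (b q)) ℂ)
    (c : Fin m → ℂ) (r : Fin n) (q : Fin m) (s : Fin (b q)) (hs : (s : ℕ) = 0) :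
    (P * Matrix.blockDiagonal' fun q => jordanBlock (b q) (c q)) r ⟨q, s⟩ =
      c q * P r ⟨q, s⟩ := by
  rw [Matrix.mul_apply, Finset.sum_eq_single ⟨q, s⟩]
  · rw [Matrix.blockDiagonal'_apply_eq, mul_comm]
    simp [jordanBlock]
  · rintro ⟨q', s'⟩ - hne
    by_cases hq : q' = q
    · subst hq
      have h1 : s' ≠ s := fun h => hne (by rw [h])
      rw [Matrix.blockDiagonal'_apply_eq]
      simp [jordanBlock, h1, hs]
    · rw [Matrix.blockDiagonal'_apply_ne _ _ _ hq, mul_zero]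
  · simp

theorem mul_blockDiagonal'_jordanBlock_apply_succ (P : Matrix (Fin n) (Σ q, Fin (b q)) ℂ)
    (c : Fin m → ℂ) (r : Fin n) (q : Fin m) (s t : Fin (b q)) (hs : (t : ℕ) + 1 = s) :
    (P * Matrix.blockDiagonal' fun q => jordanBlock (b q) (c q)) r ⟨q, s⟩ =
      c q * P r ⟨q, s⟩ + P r ⟨q, t⟩ := by
  have hts : t ≠ s := fun h => by simp [h] at hs
  have hne : (⟨q, s⟩ : Σ q, Fin (b q)) ≠ ⟨q, t⟩ := by simpa using hts.symm
  rw [Matrix.mul_apply, Fintype.sum_eq_add ⟨q, s⟩ ⟨q, t⟩ hne]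
  · rw [Matrix.blockDiagonal'_apply_eq, Matrix.blockDiagonal'_apply_eq, mul_comm]
    simp [jordanBlock, hts, hs]
  · rintro ⟨q', s'⟩ ⟨h1, h2⟩
    by_cases hq : q' = q
    · subst hq
      have h3 : s' ≠ s := fun h => h1 (by rw [h])
      have h4 : ¬ (s' : ℕ) + 1 = s := fun h => h2 (by
        rw [show s' = t from Fin.ext (by omega)])
      rw [Matrix.blockDiagonal'_apply_eq]
      simp [jordanBlock, h3, h4]
    · rw [Matrix.blockDiagonal'_apply_ne _ _ _ hq, mul_zero]

theorem mulVec_eq_smul_add {A : Matrix (Fin n) (Fin n) ℂ} (c : ℂ) (v : Fin n → ℂ) :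
    A.mulVec v = c • v + (A - c • 1).mulVec v := by
  rw [Matrix.sub_mulVec, Matrix.smul_mulVec, Matrix.one_mulVec, add_sub_cancel]

/-- A acts on a chain as c plus a shift, and the shift leaves the chain only at exponent `b q`,
where `hw` kills it. Linear independence plays no role, so the identity survives variation of A, c
and w. -/
theorem mul_chainMatrix {A : Matrix (Fin n) (Fin n) ℂ} {c : Fin m → ℂ} {w : Fin m → Fin n → ℂ}
    (hw : ∀ q, ((A - c q • 1) ^ b q).mulVec (w q) = 0) :
    A * chainMatrix b A c w =
      chainMatrix b A c w * Matrix.blockDiagonal' fun q => jordanBlock (b q) (c q) := by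
  have hleft : ∀ r q (s : Fin (b q)), (A * chainMatrix b A c w) r ⟨q, s⟩ =
      c q * chainMatrix b A c w r ⟨q, s⟩ +
        ((A - c q • 1) ^ (b q - 1 - s + 1)).mulVec (w q) r := by
    intro r q s
    have h1 : (A * chainMatrix b A c w) r ⟨q, s⟩ =
        A.mulVec (((A - c q • 1) ^ (b q - 1 - s)).mulVec (w q)) r := rfl
    rw [h1, mulVec_eq_smul_add (c q), Matrix.mulVec_mulVec, ← pow_succ']
    rfl
  ext r ⟨q, s⟩
  rw [hleft]
  obtain ⟨s, hs⟩ := s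
  cases s with
  | zero =>
    rw [mul_blockDiagonal'_jordanBlock_apply_zero _ _ _ _ _ rfl]
    have : b q - 1 - 0 + 1 = b q := by omega
    simp only [this, hw]
    simp
  | succ t =>
    rw [mul_blockDiagonal'_jordanBlock_apply_succ _ _ _ _ _ ⟨t, by omega⟩ rfl]
    have : b q - 1 - (t + 1) + 1 = b q - 1 - t := by omega
    simp only [this]
    rfl

theorem exists_eq_chainMatrix {A : Matrix (Fin n) (Fin n) ℂ} {c : Fin m → ℂ}
    (hb : ∀ q, 0 < b q) {P : Matrix (Fin n) (Σ q, Fin (b q)) ℂ}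
    (hP : A * P = P * Matrix.blockDiagonal' fun q => jordanBlock (b q) (c q)) :
    ∃ w : Fin m → Fin n → ℂ, P = chainMatrix b A c w ∧
      ∀ q, ((A - c q • 1) ^ b q).mulVec (w q) = 0 := by
  have hA : ∀ q (s : Fin (b q)) r, (A - c q • 1).mulVec (fun r => P r ⟨q, s⟩) r =
      (A * P) r ⟨q, s⟩ - c q * P r ⟨q, s⟩ := by
    intro q s r
    rw [Matrix.sub_mulVec, Matrix.smul_mulVec, Matrix.one_mulVec]
    rfl
  -- The last column of each block generates the chain: each application of A - c moves one column
  -- to the left.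
  let w : Fin m → Fin n → ℂ := fun q r => P r ⟨q, ⟨b q - 1, Nat.sub_one_lt (hb q).ne'⟩⟩
  have key : ∀ q t (ht : t < b q), ((A - c q • 1) ^ t).mulVec (w q) =
      fun r => P r ⟨q, ⟨b q - 1 - t, by omega⟩⟩ := by
    intro q t
    induction t with
    | zero => intro _; simp [w]
    | succ t ih =>
      intro ht
      rw [pow_succ', ← Matrix.mulVec_mulVec, ih (by omega)]
      ext r
      rw [hA, hP, mul_blockDiagonal'_jordanBlock_apply_succ _ _ _ _ _
        ⟨b q - 1 - (t + 1), by omega⟩ (by simp only; omega), add_sub_cancel_left]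
  refine ⟨w, ?_, fun q => ?_⟩
  · ext r ⟨q, s⟩
    have h1 := congrFun (key q (b q - 1 - s) (by have := hb q; omega)) r
    have h2 : (⟨b q - 1 - (b q - 1 - s), by omega⟩ : Fin (b q)) = s :=
      Fin.ext (by simp only; omega)
    rw [h2] at h1
    exact h1.symm
  · obtain ⟨t, ht⟩ := Nat.exists_eq_succ_of_ne_zero (hb q).ne'
    rw [show (A - c q • 1) ^ b q = (A - c q • 1) * (A - c q • 1) ^ t by rw [ht, pow_succ'],
      ← Matrix.mulVec_mulVec, key q t (by omega)]
    ext r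
    rw [hA, hP, mul_blockDiagonal'_jordanBlock_apply_zero _ _ _ _ _ (by simp only; omega),
      sub_self]
    rfl

/-- The enumeration of a nested family of blocks by a single index. -/
def flattenBlocks {k : ℕ} {l : Fin k → ℕ} (b : (i : Fin k) → Fin (l i) → ℕ) :
    (Σ q : Fin (∑ i, l i), Fin (b (finSigmaFinEquiv.symm q).1 (finSigmaFinEquiv.symm q).2)) ≃
      Σ i, Σ j, Fin (b i j) :=
  (Equiv.sigmaCongrLeft (β := fun p : Σ i, Fin (l i) => Fin (b p.1 p.2))
    finSigmaFinEquiv.symm).trans (Equiv.sigmaAssoc fun i j => Fin (b i j))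

theorem jordanForm_submatrix_flattenBlocks {k : ℕ} {l : Fin k → ℕ}
    (b : (i : Fin k) → Fin (l i) → ℕ) (μ : Fin k → ℂ) :
    (jordanForm b μ).submatrix (flattenBlocks b) (flattenBlocks b) =
      Matrix.blockDiagonal' fun q => jordanBlock
        (b (finSigmaFinEquiv.symm q).1 (finSigmaFinEquiv.symm q).2)
        (μ (finSigmaFinEquiv.symm q).1) := by
  have happ : ∀ q s, flattenBlocks b ⟨q, s⟩ =
      ⟨(finSigmaFinEquiv.symm q).1, (finSigmaFinEquiv.symm q).2, s⟩ := fun _ _ => rfl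
  ext ⟨q, s⟩ ⟨q', s'⟩
  rw [Matrix.submatrix_apply, happ, happ]
  by_cases hq : q = q'
  · subst hq
    rw [jordanForm, Matrix.blockDiagonal'_apply_eq, Matrix.blockDiagonal'_apply_eq,
      Matrix.blockDiagonal'_apply_eq]
  · rw [Matrix.blockDiagonal'_apply_ne _ _ _ hq, jordanForm]
    have hne := finSigmaFinEquiv.symm.injective.ne hq
    revert hne s s'
    generalize finSigmaFinEquiv.symm q = p
    generalize finSigmaFinEquiv.symm q' = p'
    obtain ⟨i, j⟩ := p
    obtain ⟨i', j'⟩ := p'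
    intro s s' hne
    by_cases hi : i = i'
    · subst hi
      have hj : j ≠ j' := fun h => hne (by rw [h])
      rw [Matrix.blockDiagonal'_apply_eq, Matrix.blockDiagonal'_apply_ne _ _ _ hj]
    · rw [Matrix.blockDiagonal'_apply_ne _ _ _ hi]

/-- Base-point data with the blocks in a single list; `a q` records the eigenvalue to which block
`q` belongs. -/
theorem exists_jordanBasis_of_mem_matrixBundle {lam : DoublePartition n}
    {A : Matrix (Fin n) (Fin n) ℂ} (hA : A ∈ matrixBundle lam) :
    ∃ (k : ℕ) (μ : Fin k → ℂ), lam.parts.card = k ∧ Function.Injective μ ∧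
      (∀ i, (A - μ i • 1).det = 0) ∧
      ∃ (m : ℕ) (b : Fin m → ℕ) (a : Fin m → Fin k) (h : ∑ q, b q = n)
        (P : Matrix (Fin n) (Σ q, Fin (b q)) ℂ), (∀ q, 0 < b q) ∧
        IsUnit (P.submatrix id (finSigmaFinEquiv.trans (finCongr h)).symm) ∧
        A * P = P * Matrix.blockDiagonal' fun q => jordanBlock (b q) (μ (a q)) := by
  obtain ⟨k, l, b, μ, e, S, hlam, hμ, hS⟩ := hA
  have hsum : ∑ q : Fin (∑ i, l i),
      b (finSigmaFinEquiv.symm q).1 (finSigmaFinEquiv.symm q).2 = n := by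
    simpa using Fintype.card_congr ((flattenBlocks b).trans e)
  refine ⟨k, μ, by rw [hlam]; simp, hμ, fun i =>
    (det_eq_zero_iff_of_conj_eq_jordanForm hμ hlam hS _).2 ⟨i, rfl⟩, ∑ i, l i,
    fun q => b (finSigmaFinEquiv.symm q).1 (finSigmaFinEquiv.symm q).2,
    fun q => (finSigmaFinEquiv.symm q).1, hsum,
    (S : Matrix (Fin n) (Fin n) ℂ).submatrix id ((flattenBlocks b).trans e),
    fun q => ?_, ?_, ?_⟩
  · refine lam.pos (Finset.univ.val.map (b (finSigmaFinEquiv.symm q).1)) ?_ _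
      (Multiset.mem_map_of_mem _ (Finset.mem_univ_val _))
    rw [hlam]
    exact Multiset.mem_map_of_mem (fun i => Finset.univ.val.map (b i)) (Finset.mem_univ_val _)
  · rw [Matrix.submatrix_submatrix, ← Equiv.coe_trans]
    exact (Matrix.isUnit_submatrix_equiv (Equiv.refl _) _).2 S.isUnit
  · have h1 : A * (S : Matrix (Fin n) (Fin n) ℂ) = S * Matrix.reindex e e (jordanForm b μ) := by
      rw [← hS, mul_assoc, Units.mul_inv_cancel_left]
    rw [← jordanForm_submatrix_flattenBlocks]
    have h2 : (jordanForm b μ).submatrix (flattenBlocks b) (flattenBlocks b) =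
        (Matrix.reindex e e (jordanForm b μ)).submatrix ((flattenBlocks b).trans e)
          ((flattenBlocks b).trans e) := by
      ext
      simp
    rw [h2, Matrix.submatrix_mul_equiv, ← h1]
    rfl

end JordanChains

/-! ### Local Jordanization -/

section Jordanization

open Filter Topology

theorem isJordanMatrix_of_mul_eq {n m : ℕ} {b : Fin m → ℕ} (hb : ∀ q, 0 < b q)
    (h : ∑ q, b q = n) {A : Matrix (Fin n) (Fin n) ℂ} {c : Fin m → ℂ}
    {P : Matrix (Fin n) (Σ q, Fin (b q)) ℂ}
    (hP : A * P = P * Matrix.blockDiagonal' fun q => jordanBlock (b q) (c q))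
    (S : Matrix.GeneralLinearGroup (Fin n) ℂ)
    (hS : (S : Matrix (Fin n) (Fin n) ℂ) =
      P.submatrix id (finSigmaFinEquiv.trans (finCongr h)).symm) :
    IsJordanMatrix
      ((↑S⁻¹ : Matrix (Fin n) (Fin n) ℂ) * A * (S : Matrix (Fin n) (Fin n) ℂ)) := by
  refine ⟨m, b, c, h, hb, ?_⟩
  have h1 : A * (S : Matrix (Fin n) (Fin n) ℂ) = S * Matrix.reindex
      (finSigmaFinEquiv.trans (finCongr h)) (finSigmaFinEquiv.trans (finCongr h))
      (Matrix.blockDiagonal' fun q => jordanBlock (b q) (c q)) := by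
    rw [hS, Matrix.reindex_apply, Matrix.submatrix_mul_equiv, ← hP]
    rfl
  rw [mul_assoc, h1, Units.inv_mul_cancel_left]

theorem exists_local_jordanization {E : Type*} [NormedAddCommGroup E] [NormedSpace ℂ E]
    {n : ℕ} {lam : DoublePartition n} {A : E → Matrix (Fin n) (Fin n) ℂ} {y₀ : E}
    (hA : ∀ᶠ y in 𝓝 y₀, EntriesDifferentiableAt A y ∧ A y ∈ matrixBundle lam) :
    ∃ S : E → Matrix.GeneralLinearGroup (Fin n) ℂ, ∀ᶠ y in 𝓝 y₀,
      EntriesDifferentiableAt (fun y => (S y : Matrix (Fin n) (Fin n) ℂ)) y ∧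
      IsJordanMatrix
        ((↑(S y)⁻¹ : Matrix (Fin n) (Fin n) ℂ) * A y * (S y : Matrix (Fin n) (Fin n) ℂ)) := by
  obtain ⟨k, μ₀, hk, hinj, hdet, m, b, a, h, P, hb, hunit, hP⟩ :=
    exists_jordanBasis_of_mem_matrixBundle hA.self_of_nhds.2
  obtain ⟨μ, hμ, hev⟩ := exists_differentiable_eigenvalues hk hA hinj hdet
  obtain ⟨w₀, hPw, hw₀⟩ := exists_eq_chainMatrix hb hP
  have hsection : ∀ q, ∃ w : E → Fin n → ℂ, w y₀ = w₀ q ∧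
      ∀ᶠ y in 𝓝 y₀, (∀ i, DifferentiableAt ℂ (fun x => w x i) y) ∧
        ((A y - μ (a q) y • 1) ^ b q).mulVec (w y) = 0 := by
    intro q
    -- Constancy of the nullity is available only for exponents up to n.
    have hbn : b q ≤ n := h ▸ Finset.single_le_sum (fun _ _ => Nat.zero_le _) (Finset.mem_univ q)
    refine exists_kernel_section (M := fun y => (A y - μ (a q) y • 1) ^ b q) ?_ ?_ ?_
    · filter_upwards [hA, hev] with y h1 h2
      exact (h1.1.sub_smul_one (h2.1 (a q))).pow _
    · filter_upwards [hev] with y h1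
      rw [h1.2 _ hbn, hμ]
    · simpa only [hμ] using hw₀ q
  choose w hwy₀ hw using hsection
  let T : E → Matrix (Fin n) (Fin n) ℂ := fun y =>
    (chainMatrix b (A y) (fun q => μ (a q) y) (fun q => w q y)).submatrix id
      (finSigmaFinEquiv.trans (finCongr h)).symm
  have hT : ∀ᶠ y in 𝓝 y₀, EntriesDifferentiableAt T y := by
    filter_upwards [hA, hev, eventually_all.2 hw] with y h1 h2 h3 i j
    exact ((h1.1.sub_smul_one (h2.1 _)).pow _).mulVec (h3 _).1 i
  have hT₀ : IsUnit (T y₀) := by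
    simp only [T, hμ, hwy₀]
    rwa [← hPw]
  have hTu : ∀ᶠ y in 𝓝 y₀, IsUnit (T y) := eventually_isUnit hT.self_of_nhds.continuousAt hT₀
  classical
  let S : E → Matrix.GeneralLinearGroup (Fin n) ℂ := fun y =>
    if hy : IsUnit (T y) then hy.unit else 1
  have hST : ∀ y, IsUnit (T y) → (S y : Matrix (Fin n) (Fin n) ℂ) = T y := by
    intro y hy
    simp only [S, dif_pos hy, IsUnit.unit_spec]
  refine ⟨S, ?_⟩
  filter_upwards [hT, hTu.eventually_nhds, eventually_all.2 hw] with y h1 h2 h3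
  refine ⟨fun i j => (h1 i j).congr_of_eventuallyEq ?_, ?_⟩
  · filter_upwards [h2] with x hx
    rw [hST x hx]
  · exact isJordanMatrix_of_mul_eq hb h (mul_chainMatrix fun q => (h3 q).2) (S y)
      (hST y h2.self_of_nhds)

end Jordanization

/-! ### Transfer from a chart to the manifold -/

theorem mainTheorem6 {E : Type*} [NormedAddCommGroup E] [NormedSpace ℂ E] [FiniteDimensional ℂ E]
    {X : Type*} [TopologicalSpace X] [ChartedSpace E X] [IsManifold 𝓘(ℂ, E) ω X]
    {n : ℕ} (A : X → Matrix (Fin n) (Fin n) ℂ)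
    (hA : HolomorphicMatrixOn E A Set.univ)
    (lam : DoublePartition n) (hlam : ∀ x, A x ∈ matrixBundle lam) :
    ∀ x₀ : X, LocallyHolomorphicallyJordanizableAt E A x₀ := by
  intro x₀
  -- C^1 regularity suffices for charts and their inverses to be differentiable.
  have : IsManifold 𝓘(ℂ, E) 1 X := IsManifold.of_le (n := ω) le_top
  set φ := chartAt E x₀ with hφ
  have hmem : φ ∈ atlas E X := chart_mem_atlas E x₀
  have hx₀ : x₀ ∈ φ.source := mem_chart_source E x₀
  have hloc : ∀ᶠ y in nhds (φ x₀), EntriesDifferentiableAt (fun y => A (φ.symm y)) y ∧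
      A (φ.symm y) ∈ matrixBundle lam := by
    filter_upwards [φ.open_target.mem_nhds (φ.map_source hx₀)] with y hy
    refine ⟨fun i j => ?_, hlam _⟩
    rw [← mdifferentiableAt_iff_differentiableAt]
    have h1 : MDifferentiableAt 𝓘(ℂ, E) 𝓘(ℂ, ℂ) (fun x => A x i j) (φ.symm y) :=
      (hA i j _ (Set.mem_univ _)).mdifferentiableAt Filter.univ_mem
    exact h1.comp y (mdifferentiableAt_atlas_symm hmem hy)
  obtain ⟨S, hS⟩ := exists_local_jordanization hloc
  obtain ⟨V, hV, hVo, hxV⟩ := eventually_nhds_iff.1 hS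
  refine ⟨φ.source ∩ φ ⁻¹' V, φ.isOpen_inter_preimage hVo, ⟨hx₀, hxV⟩, fun x => S (φ x), ?_, ?_⟩
  · rintro i j x ⟨hx, hxV⟩
    have h1 := mdifferentiableAt_iff_differentiableAt.2 ((hV _ hxV).1 i j)
    exact (h1.comp x (mdifferentiableAt_atlas hmem hx)).mdifferentiableWithinAt
  · rintro x ⟨hx, hxV⟩
    have h1 := (hV _ hxV).2
    simp only [φ.left_inv hx] at h1
    exact h1
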